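/- Let $K$ be an algebraically closed field of characteristic zero, let $d\ge 1$, let $S_d$ be the space of homogeneous polynomials of degree $d$ in two variables over $K$, and let $S_d^*$ be its dual. For $\alpha\in K^2$ let $ev(\alpha)\in S_d^*$ be evaluation at $\alpha$, and let the rank $\operatorname{rk}\varphi$ of $\varphi\in S_d^*$ be the least integer $r$ such that $\varphi=ev(\alpha_1)+\dots+ev(\alpha_r)$ for some $\alpha_1,\dots,\alpha_r\in K^2$. Let $X\subset\mathbb P(S_d^*)$ be the Veronese curve, that is, the image of $\mathbb P^1(K)\to\mathbb P(S_d^*)$, $[\alpha]\mapsto[ev(\alpha)]$, and let $\sigma^k(X)$ be the Zariski closure of the union of all $k$-planes spanned by $k+1$ points of $X$. Let $0\le k\le\left[\frac{d-1}{2}\right]$ and let $\varphi\in S_d^*$ be nonzero. If $[\varphi]\in\sigma^k(X)$ does not lie on any $k$-plane spanned by $k+1$ points of $X$, then $\operatorname{rk}\varphi\ge d-k+1$. -/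

import Mathlib

open scoped LinearAlgebra.Projectivization

noncomputable section

namespace BinaryForms

/-- The space `S_d` of homogeneous polynomials of degree `d` in two variables over `K`. -/
abbrev Form (K : Type*) [Field K] (d : ℕ) : Type _ :=
  MvPolynomial.homogeneousSubmodule (Fin 2) K d

/-- The dual space `S_d^*`. -/
abbrev Functional (K : Type*) [Field K] (d : ℕ) : Type _ :=
  Module.Dual K (Form K d)

variable {K : Type*} [Field K]

/-- The functional `ev(α) ∈ S_d^*`, evaluation of forms of degree `d` at `α ∈ K^2`. -/
def ev (d : ℕ) (α : Fin 2 → K) : Functional K d :=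
  (MvPolynomial.aeval α).toLinearMap ∘ₗ (MvPolynomial.homogeneousSubmodule (Fin 2) K d).subtype

theorem ev_apply (d : ℕ) (α : Fin 2 → K) (f : Form K d) :
    ev d α f = MvPolynomial.eval α (f : MvPolynomial (Fin 2) K) := by
  simp [ev, MvPolynomial.aeval_eq_eval]

theorem ev_ne_zero (d : ℕ) {α : Fin 2 → K} (hα : α ≠ 0) : ev d α ≠ 0 := by
  obtain ⟨i, hi⟩ := Function.ne_iff.mp hα
  intro h
  have h1 := congrArg
    (fun φ : Functional K d => φ ⟨MvPolynomial.X i ^ d, MvPolynomial.isHomogeneous_X_pow i d⟩) h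
  simp only [ev_apply, map_pow, MvPolynomial.eval_X, LinearMap.zero_apply] at h1
  exact pow_ne_zero d hi h1

/-- The monomial `x^{d-i} y^i`, for `0 ≤ i ≤ d`, as an element of `S_d`. -/
def monom (K : Type*) [Field K] (d : ℕ) (i : Fin (d + 1)) : Form K d :=
  ⟨MvPolynomial.X 0 ^ (d - (i : ℕ)) * MvPolynomial.X 1 ^ (i : ℕ), by
    have h := (MvPolynomial.isHomogeneous_X_pow (R := K) (0 : Fin 2) (d - (i : ℕ))).mul
      (MvPolynomial.isHomogeneous_X_pow (1 : Fin 2) (i : ℕ))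
    rwa [Nat.sub_add_cancel (Nat.le_of_lt_succ i.isLt)] at h⟩

/-- The coordinates `Z_i = φ(x^{d-i} y^i)` of `φ ∈ S_d^*`. -/
def coords (d : ℕ) (φ : Functional K d) : Fin (d + 1) → K :=
  fun i => φ (monom K d i)

/-- The rank of `φ`: the least `r` such that `φ = ev(α_1) + ... + ev(α_r)` for some `α_i ∈ K^2`. -/
def rank (d : ℕ) (φ : Functional K d) : ℕ :=
  sInf {r : ℕ | ∃ α : Fin r → (Fin 2 → K), φ = ∑ i, ev d (α i)}

/-- The Veronese curve `X ⊆ ℙ(S_d^*)`, the image of `[α] ↦ [ev(α)]`. -/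
def veronese (K : Type*) [Field K] (d : ℕ) : Set (ℙ K (Functional K d)) :=
  {P | ∃ (α : Fin 2 → K) (hα : α ≠ 0), P = Projectivization.mk K (ev d α) (ev_ne_zero d hα)}

/-- `P` lies on a `k`-plane spanned by `k + 1` points of the Veronese curve. (That the `k + 1`
points span a linear space of dimension exactly `k` is their independence.) -/
def OnSecantPlane (d k : ℕ) (P : ℙ K (Functional K d)) : Prop :=
  ∃ p : Fin (k + 1) → ℙ K (Functional K d),
    (∀ i, p i ∈ veronese K d) ∧ Projectivization.Independent p ∧
      P ∈ Projectivization.Subspace.span (Set.range p)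

/-- Zariski closure in `ℙ(S_d^*)`: the common zeros of all homogeneous polynomials in the
homogeneous coordinates `Z_0, ..., Z_d` that vanish on `T`. -/
def zariskiClosure (d : ℕ) (T : Set (ℙ K (Functional K d))) : Set (ℙ K (Functional K d)) :=
  {P | ∀ (m : ℕ) (F : MvPolynomial (Fin (d + 1)) K), F.IsHomogeneous m →
    (∀ Q ∈ T, MvPolynomial.eval (coords d Q.rep) F = 0) →
      MvPolynomial.eval (coords d P.rep) F = 0}

/-- The secant variety `σ^k(X)`: the Zariski closure of the union of the `k`-planes spanned by
`k + 1` points of the Veronese curve `X`. -/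
def secantVariety (K : Type*) [Field K] (d k : ℕ) : Set (ℙ K (Functional K d)) :=
  zariskiClosure d {P | OnSecantPlane d k P}

end BinaryForms

end

/-!
The argument is by apolarity. A form `g` of degree `m` contracts a functional `φ` on forms of
degree `m + n` to the functional `h ↦ φ (g * h)` on forms of degree `n`; it sends `ev(p)` to
`g(p) ev(p)`. A combination of `k + 1` evaluations is therefore killed by a nonzero form of degree
`k + 1` vanishing at these points. That `φ` is killed by some nonzero form of degree `k + 1` means
that all maximal minors of its catalecticant matrix vanish, a closed condition, so it persists on
`σ^k(X)`.

Let `g` be such a form for `[φ] ∈ σ^k(X)`, and suppose that `rk φ ≤ d - k`. Then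
`φ = ∑ c_p ev(p)` over at most `d - k` points, and contraction with `g` gives `∑ c_p g(p) ev(p) = 0`
in degree `d - k - 1`. There evaluations at `d - k` points are still independent, so `c_p = 0`
unless `g(p) = 0`. As `g` has at most `k + 1` zeros, `[φ]` lies on a `k`-plane spanned by points of
`X`.
-/

open Matrix MvPolynomial

namespace BinaryForms

section General

theorem separatingLeft_iff_exists_det_submatrix_ne_zero {F ι κ : Type*} [Field F]
    [Fintype ι] [DecidableEq ι] [Finite κ] (A : Matrix ι κ F) :
    A.SeparatingLeft ↔ ∃ e : ι → κ, (A.submatrix id e).det ≠ 0 := by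
  have := Fintype.ofFinite κ
  rw [separatingLeft_iff_forall_vecMul_eq_zero]
  constructor
  · intro hA
    have hrows : LinearIndependent F A.row := by
      rw [← vecMul_injective_iff]
      exact (injective_iff_map_eq_zero A.vecMulLinear).mpr hA
    obtain ⟨μ, a, ha, hspan, hcols⟩ := exists_linearIndependent' F A.col
    have : Finite μ := Finite.of_injective a ha
    have := Fintype.ofFinite μ
    have hcard : Fintype.card ι = Fintype.card μ := by
      rw [← finrank_span_eq_card hcols, hspan, ← rank_eq_finrank_span_cols, hrows.rank_matrix]
    let e : ι ≃ μ := Fintype.equivOfCardEq hcard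
    have hminor : LinearIndependent F (A.submatrix id (a ∘ e)).col := hcols.comp e e.injective
    exact ⟨a ∘ e, ((isUnit_iff_isUnit_det _).mp
      (linearIndependent_cols_iff_isUnit.mp hminor)).ne_zero⟩
  · rintro ⟨e, he⟩ v hv
    refine eq_zero_of_vecMul_eq_zero he (funext fun j => ?_)
    exact congrFun hv (e j)

theorem isHomogeneous_det {ι σ R : Type*} [Fintype ι] [DecidableEq ι] [CommRing R] {r : ℕ}
    (M : Matrix ι ι (MvPolynomial σ R)) (hM : ∀ i j, (M i j).IsHomogeneous r) :
    M.det.IsHomogeneous (Fintype.card ι * r) := by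
  rw [det_apply]
  refine IsHomogeneous.sum _ _ _ fun τ _ => ?_
  have hprod : (∏ i, M (τ i) i).IsHomogeneous (Fintype.card ι * r) := by
    simpa using IsHomogeneous.prod Finset.univ (fun i => M (τ i) i) (fun _ => r)
      fun i _ => hM _ _
  exact ((homogeneousSubmodule σ R _).restrictScalars ℤ).smul_mem (Equiv.Perm.sign τ : ℤ) hprod

variable {D V : Type*} [DivisionRing D] [AddCommGroup V] [Module D V]

theorem mk_mem_span_range_mk_iff {ι : Type*} (w : ι → V) (hw : ∀ i, w i ≠ 0) {x : V}
    (hx : x ≠ 0) :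
    Projectivization.mk D x hx ∈
        Projectivization.Subspace.span (Set.range fun i => Projectivization.mk D (w i) (hw i)) ↔
      x ∈ Submodule.span D (Set.range w) := by
  constructor
  · intro h
    rw [← Submodule.mk_mem_projectivization_iff _ hx]
    refine (Projectivization.Subspace.mem_span _).mp h _ ?_
    rintro _ ⟨i, rfl⟩
    exact (Submodule.mk_mem_projectivization_iff _ (hw i)).mpr
      (Submodule.subset_span (Set.mem_range_self i))
  · intro h
    rw [← Projectivization.Subspace.mem_submodule_iff _ hx]
    refine Submodule.span_le.mpr ?_ h
    rintro _ ⟨i, rfl⟩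
    exact (Projectivization.Subspace.mem_submodule_iff _ (hw i)).mpr
      (Projectivization.Subspace.subset_span _ (Set.mem_range_self i))

theorem exists_smul_rep_eq [Nontrivial V] (x : V) : ∃ (c : D) (p : ℙ D V), c • p.rep = x := by
  by_cases hx : x = 0
  · obtain ⟨y, hy⟩ := exists_ne (0 : V)
    exact ⟨0, Projectivization.mk D y hy, by rw [zero_smul, hx]⟩
  · obtain ⟨a, ha⟩ := Projectivization.exists_smul_eq_mk_rep D x hx
    exact ⟨↑a⁻¹, Projectivization.mk D x hx, by rw [← ha, ← Units.smul_def, inv_smul_smul]⟩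

instance infinite_projectiveLine [Infinite D] : Infinite (ℙ D (Fin 2 → D)) := by
  classical
  exact .of_injective _ ((OnePoint.equivProjectivization D).injective.comp OnePoint.coe_injective)

theorem rep_mul_rep_eq_iff {F : Type*} [Field F] {p q : ℙ F (Fin 2 → F)} :
    p.rep 0 * q.rep 1 = p.rep 1 * q.rep 0 ↔ p = q := by
  rw [← not_iff_not, ← ne_eq p, ← Projectivization.linearIndependent_pair_iff_ne,
    ← sub_eq_zero, ← ne_eq, ← det_fin_two_of, ← isUnit_iff_ne_zero, ← isUnit_iff_isUnit_det,
    ← linearIndependent_rows_iff_isUnit]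
  have hrow : (!![p.rep 0, p.rep 1; q.rep 0, q.rep 1] : Matrix _ _ F).row = ![p.rep, q.rep] := by
    ext i j
    fin_cases i <;> fin_cases j <;> rfl
  rw [hrow]

end General

variable {K : Type*} [Field K] {d m n r : ℕ}

section MonomialBasis

theorem coe_monom (d : ℕ) (i : Fin (d + 1)) :
    (monom K d i : MvPolynomial (Fin 2) K) =
      monomial (Finsupp.single 0 (d - i) + Finsupp.single 1 (i : ℕ)) 1 := by
  simp [monom, X_pow_eq_monomial, monomial_mul]

theorem linearIndependent_monom (K : Type*) [Field K] (d : ℕ) :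
    LinearIndependent K (monom K d) := by
  have hexp : Function.Injective fun i : Fin (d + 1) =>
      (Finsupp.single 0 (d - i) + Finsupp.single 1 (i : ℕ) : Fin 2 →₀ ℕ) := fun i j hij =>
    Fin.ext (by simpa using DFunLike.congr_fun hij 1)
  refine LinearIndependent.of_comp (homogeneousSubmodule (Fin 2) K d).subtype ?_
  have hcoe : ⇑(homogeneousSubmodule (Fin 2) K d).subtype ∘ monom K d =
      ⇑(basisMonomials (Fin 2) K) ∘ fun i : Fin (d + 1) =>
        Finsupp.single 0 (d - i) + Finsupp.single 1 (i : ℕ) := funext fun i => by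
    rw [Function.comp_apply, Function.comp_apply, Submodule.subtype_apply, coe_monom,
      coe_basisMonomials]
  rw [hcoe]
  exact (basisMonomials (Fin 2) K).linearIndependent.comp _ hexp

theorem span_range_monom (K : Type*) [Field K] (d : ℕ) :
    Submodule.span K (Set.range (monom K d)) = ⊤ := by
  refine eq_top_iff.mpr fun f _ => ?_
  suffices hmap : (f : MvPolynomial (Fin 2) K) ∈
      (Submodule.span K (Set.range (monom K d))).map (homogeneousSubmodule (Fin 2) K d).subtype by
    obtain ⟨g, hg, hgf⟩ := hmap
    exact Subtype.ext hgf ▸ hg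
  rw [(f : MvPolynomial (Fin 2) K).as_sum]
  refine Submodule.sum_mem _ fun s hs => ?_
  have hdeg : s 0 + s 1 = d := by
    simpa [Finsupp.weight_apply, Finsupp.sum_fintype] using f.2 (mem_support_iff.mp hs)
  have hs_eq : s = Finsupp.single 0 (d - s 1) + Finsupp.single 1 (s 1) := by
    ext i
    fin_cases i <;> simp [← hdeg]
  refine ⟨coeff s (f : MvPolynomial (Fin 2) K) • monom K d ⟨s 1, by omega⟩,
    Submodule.smul_mem _ _ (Submodule.subset_span (Set.mem_range_self _)), ?_⟩
  rw [map_smul, Submodule.subtype_apply, coe_monom, ← hs_eq, smul_monomial, smul_eq_mul, mul_one]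

/-- The monomials `x^{d-i} y^i`, as a basis of `S_d`. -/
noncomputable def monomBasis (K : Type*) [Field K] (d : ℕ) :
    Module.Basis (Fin (d + 1)) K (Form K d) :=
  .mk (linearIndependent_monom K d) (span_range_monom K d).ge

@[simp]
theorem monomBasis_apply (d : ℕ) (i : Fin (d + 1)) : monomBasis K d i = monom K d i :=
  Module.Basis.mk_apply _ _ i

instance finite_form : Module.Finite K (Form K d) := .of_basis (monomBasis K d)

theorem finrank_form (K : Type*) [Field K] (d : ℕ) : Module.finrank K (Form K d) = d + 1 := by
  rw [Module.finrank_eq_card_basis (monomBasis K d), Fintype.card_fin]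

end MonomialBasis

section Evaluation

theorem ev_smul (c : K) (α : Fin 2 → K) : ev d (c • α) = c ^ d • ev d α := by
  refine (monomBasis K d).ext fun i => ?_
  have hpow : c ^ d = c ^ (d - i : ℕ) * c ^ (i : ℕ) := by rw [← pow_add]; congr 1; omega
  simp only [monomBasis_apply, LinearMap.smul_apply, ev_apply, monom, map_mul, map_pow, eval_X,
    Pi.smul_apply, smul_eq_mul, hpow]
  ring

/-- Evaluation at the chosen representative of a point of the projective line. Another
representative changes it by a nonzero scalar only. -/
noncomputable def evRep (d : ℕ) (p : ℙ K (Fin 2 → K)) : Functional K d :=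
  ev d p.rep

theorem evRep_ne_zero (d : ℕ) (p : ℙ K (Fin 2 → K)) : evRep d p ≠ 0 :=
  ev_ne_zero d p.rep_nonzero

theorem exists_form_separating {T : Finset (ℙ K (Fin 2 → K))} (hT : T.card ≤ d)
    {p : ℙ K (Fin 2 → K)} (hp : p ∉ T) :
    ∃ f : Form K d, evRep d p f ≠ 0 ∧ ∀ q ∈ T, evRep d q f = 0 := by
  let ℓ (q : ℙ K (Fin 2 → K)) : MvPolynomial (Fin 2) K := X 0 * C (q.rep 1) - X 1 * C (q.rep 0)
  have hℓ (q) : (ℓ q).IsHomogeneous 1 :=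
    ((isHomogeneous_X _ _).mul (isHomogeneous_C _ _)).sub
      ((isHomogeneous_X _ _).mul (isHomogeneous_C _ _))
  have heval (q s) : eval s.rep (ℓ q) = 0 ↔ s = q := by
    simp only [ℓ, map_sub, map_mul, eval_X, eval_C, sub_eq_zero, rep_mul_rep_eq_iff]
  obtain ⟨i, hi⟩ := Function.ne_iff.mp p.rep_nonzero
  have hf : ((∏ q ∈ T, ℓ q) * X i ^ (d - T.card)).IsHomogeneous d := by
    convert (IsHomogeneous.prod T ℓ (fun _ => 1) fun q _ => hℓ q).mul
      (isHomogeneous_X_pow i (d - T.card))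
    simp [hT]
  refine ⟨⟨_, hf⟩, ?_, fun q hq => ?_⟩
  · simp only [evRep, ev_apply, map_mul, map_prod, map_pow, eval_X]
    refine mul_ne_zero (Finset.prod_ne_zero_iff.mpr fun q hq => ?_) (pow_ne_zero _ hi)
    rw [ne_eq, heval]
    rintro rfl
    exact hp hq
  · simp only [evRep, ev_apply, map_mul, map_prod]
    rw [Finset.prod_eq_zero hq ((heval q q).mpr rfl), zero_mul]

theorem linearIndepOn_evRep {T : Finset (ℙ K (Fin 2 → K))} (hT : T.card ≤ d + 1) :
    LinearIndepOn K (evRep d) (T : Set (ℙ K (Fin 2 → K))) := by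
  classical
  refine linearIndepOn_finset_iff.mpr fun c hc p hp => ?_
  obtain ⟨f, hfp, hf⟩ := exists_form_separating (d := d) (T := T.erase p)
    (by rw [Finset.card_erase_of_mem hp]; omega) (Finset.notMem_erase p T)
  have hcf : ∑ q ∈ T, c q * evRep d q f = 0 := by simpa using LinearMap.congr_fun hc f
  rw [Finset.sum_eq_single_of_mem p hp fun q hq hqp => by
    rw [hf q (Finset.mem_erase.mpr ⟨hqp, hq⟩), mul_zero]] at hcf
  exact (mul_eq_zero.mp hcf).resolve_right hfp

theorem span_evRep_eq_top {T : Finset (ℙ K (Fin 2 → K))} (hT : T.card = d + 1) :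
    Submodule.span K (evRep d '' (T : Set (ℙ K (Fin 2 → K)))) = ⊤ := by
  rw [Set.image_eq_range]
  exact (linearIndepOn_evRep hT.le).span_eq_top_of_card_eq_finrank' (by
    rw [Subspace.dual_finrank_eq, finrank_form]; simpa using hT)

theorem eq_zero_of_evRep_eq_zero {g : Form K d} {T : Finset (ℙ K (Fin 2 → K))}
    (hT : d < T.card) (hg : ∀ p ∈ T, evRep d p g = 0) : g = 0 := by
  obtain ⟨U, hUT, hU⟩ := Finset.exists_subset_card_eq (Nat.succ_le_of_lt hT)
  have hker : Submodule.span K (evRep d '' U) ≤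
      LinearMap.ker (Module.Dual.eval K (Form K d) g) := by
    rw [Submodule.span_le]
    rintro _ ⟨p, hp, rfl⟩
    exact hg p (hUT hp)
  rw [span_evRep_eq_top hU] at hker
  exact (Module.forall_dual_apply_eq_zero_iff K g).mp fun φ => hker Submodule.mem_top

end Evaluation

section SpannedByPoints

/-- `φ` is a linear combination of the evaluations at `r` or fewer points of the projective line.
Unlike in the rank, the coefficients are arbitrary. -/
def SpannedByPoints (r : ℕ) (φ : Functional K d) : Prop :=
  ∃ T : Finset (ℙ K (Fin 2 → K)), T.card ≤ r ∧ φ ∈ Submodule.span K (evRep d '' T)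

namespace SpannedByPoints

theorem mono {φ : Functional K d} {s : ℕ} (hrs : r ≤ s) :
    SpannedByPoints r φ → SpannedByPoints s φ
  | ⟨T, hT, hφ⟩ => ⟨T, hT.trans hrs, hφ⟩

theorem smul {φ : Functional K d} (c : K) : SpannedByPoints r φ → SpannedByPoints r (c • φ)
  | ⟨T, hT, hφ⟩ => ⟨T, hT, Submodule.smul_mem _ c hφ⟩

theorem of_mem_span_range_ev {ι : Type*} [Fintype ι] {α : ι → Fin 2 → K} {φ : Functional K d}
    (hφ : φ ∈ Submodule.span K (Set.range fun i => ev d (α i))) :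
    SpannedByPoints (Fintype.card ι) φ := by
  classical
  choose c p hcp using fun i => exists_smul_rep_eq (D := K) (α i)
  refine ⟨Finset.univ.image p, Finset.card_image_le, Submodule.span_le.mpr ?_ hφ⟩
  rintro _ ⟨i, rfl⟩
  simp only [SetLike.mem_coe]
  rw [← hcp i, ev_smul]
  exact Submodule.smul_mem _ _ (Submodule.subset_span ⟨p i, by simp, rfl⟩)

end SpannedByPoints

theorem exists_eq_sum_ev [IsAlgClosed K] (hd : d ≠ 0) (φ : Functional K d) :
    ∃ (r : ℕ) (α : Fin r → Fin 2 → K), φ = ∑ i, ev d (α i) := by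
  obtain ⟨T, hT⟩ := Infinite.exists_subset_card_eq (ℙ K (Fin 2 → K)) (d + 1)
  have hφ : φ ∈ Submodule.span K (evRep d '' T) := span_evRep_eq_top hT ▸ Submodule.mem_top
  obtain ⟨c, rfl⟩ := (Submodule.mem_span_image_finset_iff_exists_fun K).mp hφ
  choose t ht using fun p => IsAlgClosed.exists_pow_nat_eq (c p) (Nat.pos_of_ne_zero hd)
  refine ⟨T.card, fun i => t (T.equivFin.symm i) • (T.equivFin.symm i).1.rep, ?_⟩
  simp only [ev_smul, ht]
  exact (Equiv.sum_comp T.equivFin.symm fun p => c p • evRep d p.1).symm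

theorem spannedByPoints_rank [IsAlgClosed K] (hd : d ≠ 0) (φ : Functional K d) :
    SpannedByPoints (rank d φ) φ := by
  obtain ⟨α, hα⟩ : ∃ α : Fin (rank d φ) → Fin 2 → K, φ = ∑ i, ev d (α i) :=
    Nat.sInf_mem (exists_eq_sum_ev hd φ)
  have hφ : φ ∈ Submodule.span K (Set.range fun i => ev d (α i)) :=
    Set.mem_of_eq_of_mem hα
      (Submodule.sum_mem _ fun i _ => Submodule.subset_span (Set.mem_range_self i))
  simpa using SpannedByPoints.of_mem_span_range_ev hφ

theorem OnSecantPlane.spannedByPoints {k : ℕ} {P : ℙ K (Functional K d)}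
    (hP : OnSecantPlane d k P) : SpannedByPoints (k + 1) P.rep := by
  obtain ⟨p, hp, -, hmem⟩ := hP
  choose α hα hpα using hp
  obtain rfl : p = fun i => Projectivization.mk K (ev d (α i)) (ev_ne_zero d (hα i)) := funext hpα
  rw [← P.mk_rep, mk_mem_span_range_mk_iff] at hmem
  simpa using SpannedByPoints.of_mem_span_range_ev hmem

theorem SpannedByPoints.onSecantPlane [Infinite K] {k : ℕ} (hk : k ≤ d)
    {P : ℙ K (Functional K d)} (hP : SpannedByPoints (k + 1) P.rep) : OnSecantPlane d k P := by
  obtain ⟨T, hT, hmem⟩ := hP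
  obtain ⟨U, hTU, hU⟩ := Infinite.exists_superset_card_eq T (k + 1) hT
  let e : Fin (k + 1) ≃ U := (U.equivFinOfCardEq hU).symm
  have hne (i) : evRep d (e i).1 ≠ 0 := evRep_ne_zero d _
  have hindep : LinearIndependent K fun i => evRep d (e i).1 :=
    (linearIndepOn_evRep (by omega)).comp e e.injective
  refine ⟨fun i => Projectivization.mk K _ (hne i),
    fun i => ⟨(e i).1.rep, (e i).1.rep_nonzero, rfl⟩, .mk _ hne hindep, ?_⟩
  rw [← P.mk_rep, mk_mem_span_range_mk_iff]
  refine Submodule.span_mono ?_ hmem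
  rintro _ ⟨p, hp, rfl⟩
  exact ⟨e.symm ⟨p, hTU hp⟩, by simp⟩

end SpannedByPoints

section Apolarity

/-- The contraction `S_m × S_{m+n}^* → S_n^*`, sending `(g, φ)` to `h ↦ φ(g h)`. The form `g` is
apolar to `φ` when its contraction with `φ` vanishes. -/
noncomputable def contract : Form K m →ₗ[K] Functional K (m + n) →ₗ[K] Functional K n :=
  Module.Dual.transpose ∘ₗ DirectSum.gMulLHom K fun i => Form K i

theorem contract_apply (g : Form K m) (φ : Functional K (m + n)) (h : Form K n) :
    contract g φ h = φ ⟨g * h, g.2.mul h.2⟩ :=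
  rfl

theorem contract_evRep (g : Form K m) (p : ℙ K (Fin 2 → K)) :
    contract g (evRep (m + n) p) = evRep m p g • evRep n p := by
  ext h
  simp [contract_apply, evRep, ev_apply]

namespace SpannedByPoints

theorem exists_contract_eq_zero {φ : Functional K (m + n)} (hφ : SpannedByPoints m φ) :
    ∃ g : Form K m, g ≠ 0 ∧ contract g φ = 0 := by
  obtain ⟨T, hT, hmem⟩ := hφ
  obtain ⟨g, hg, hg0⟩ := (Submodule.ne_bot_iff _).mp
    (LinearMap.ker_ne_bot_of_finrank_lt (f := LinearMap.pi fun p : T => evRep m p.1)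
      (by rw [finrank_form]; simpa using Nat.lt_succ_of_le hT))
  refine ⟨g, hg0, ?_⟩
  have hker : Submodule.span K (evRep (m + n) '' T) ≤ LinearMap.ker (contract (n := n) g) := by
    rw [Submodule.span_le]
    rintro _ ⟨p, hp, rfl⟩
    have hgp : evRep m p g = 0 := congrFun (LinearMap.mem_ker.mp hg) ⟨p, hp⟩
    rw [SetLike.mem_coe, LinearMap.mem_ker, contract_evRep, hgp, zero_smul]
  exact hker hmem

theorem of_contract_eq_zero {φ : Functional K (m + n)} (hφ : SpannedByPoints (n + 1) φ)
    {g : Form K m} (hg : g ≠ 0) (hgφ : contract g φ = 0) : SpannedByPoints m φ := by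
  classical
  obtain ⟨T, hT, hmem⟩ := hφ
  obtain ⟨c, rfl⟩ := (Submodule.mem_span_image_finset_iff_exists_fun' K).mp hmem
  have hsum : ∑ p ∈ T, (c p * evRep m p g) • evRep n p = 0 := by
    simpa only [map_sum, map_smul, contract_evRep, mul_smul] using hgφ
  have hindep : LinearIndepOn K (evRep n) (T : Set (ℙ K (Fin 2 → K))) := linearIndepOn_evRep hT
  have hzero : ∀ p ∈ T, c p * evRep m p g = 0 := linearIndepOn_finset_iff.mp hindep _ hsum
  let U := T.filter fun p => evRep m p g = 0
  have hU : U.card ≤ m := by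
    by_contra! hlt
    exact hg (eq_zero_of_evRep_eq_zero hlt fun p hp => (Finset.mem_filter.mp hp).2)
  refine ⟨U, hU, Submodule.sum_mem _ fun p hp => ?_⟩
  by_cases hgp : evRep m p g = 0
  · exact Submodule.smul_mem _ _
      (Submodule.subset_span ⟨p, Finset.mem_filter.mpr ⟨hp, hgp⟩, rfl⟩)
  · rw [(mul_eq_zero.mp (hzero p hp)).resolve_right hgp, zero_smul]
    exact Submodule.zero_mem _

end SpannedByPoints

/-- The catalecticant matrix `(Z_{i+j})`, with `0 ≤ i ≤ m` and `0 ≤ j ≤ n`. Its entries lie in an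
arbitrary type, so that its minors can also be formed as polynomials in the `Z_i`. -/
def catalecticant {R : Type*} (z : Fin (m + n + 1) → R) : Matrix (Fin (m + 1)) (Fin (n + 1)) R :=
  of fun i j => z ⟨i + j, by omega⟩

theorem toMatrix₂_contract_flip (φ : Functional K (m + n)) :
    LinearMap.toMatrix₂ (monomBasis K m) (monomBasis K n) (contract.flip φ) =
      catalecticant (coords (m + n) φ) := by
  ext i j
  rw [LinearMap.toMatrix₂_apply, LinearMap.flip_apply, contract_apply]
  refine congrArg φ (Subtype.ext ?_)
  have hsub : m + n - (i + j : ℕ) = (m - i) + (n - j) := by omega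
  simp only [monomBasis_apply, monom, hsub, pow_add]
  ring

theorem exists_contract_eq_zero_iff (φ : Functional K (m + n)) :
    (∃ g : Form K m, g ≠ 0 ∧ contract g φ = 0) ↔
      ∀ e : Fin (m + 1) → Fin (n + 1),
        ((catalecticant (coords (m + n) φ)).submatrix id e).det = 0 := by
  rw [← not_iff_not]
  push Not
  rw [← separatingLeft_iff_exists_det_submatrix_ne_zero, ← toMatrix₂_contract_flip,
    LinearMap.separatingLeft_toMatrix₂_iff, LinearMap.separatingLeft_iff_linear_nontrivial]
  exact forall_congr' fun g => not_imp_not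

theorem exists_contract_eq_zero_of_mem_secantVariety {k : ℕ}
    {P : ℙ K (Functional K (k + 1 + n))} (hP : P ∈ secantVariety K (k + 1 + n) k) :
    ∃ g : Form K (k + 1), g ≠ 0 ∧ contract g P.rep = 0 := by
  refine (exists_contract_eq_zero_iff _).mpr fun e => ?_
  let minor : MvPolynomial (Fin (k + 1 + n + 1)) K := ((catalecticant X).submatrix id e).det
  have heval (z) : eval z minor = ((catalecticant z).submatrix id e).det := by
    rw [RingHom.map_det]
    congr 1
    ext i j
    simp [catalecticant]
  rw [← heval]
  refine hP _ _ (isHomogeneous_det _ fun i j => isHomogeneous_X _ _) fun Q hQ => ?_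
  rw [heval]
  exact (exists_contract_eq_zero_iff _).mp hQ.spannedByPoints.exists_contract_eq_zero e

end Apolarity

end BinaryForms

theorem mainTheorem2_general {K : Type*} [Field K] [IsAlgClosed K] {d k : ℕ} (hk : k < d)
    (φ : BinaryForms.Functional K d) (hφ : φ ≠ 0)
    (hsec : Projectivization.mk K φ hφ ∈ BinaryForms.secantVariety K d k)
    (hplane : ¬ BinaryForms.OnSecantPlane d k (Projectivization.mk K φ hφ)) :
    d - k + 1 ≤ BinaryForms.rank d φ := by
  obtain ⟨n, rfl⟩ := Nat.exists_eq_add_of_le (Nat.succ_le_of_lt hk)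
  by_contra! hlt
  obtain ⟨a, ha⟩ := Projectivization.exists_smul_eq_mk_rep K φ hφ
  obtain ⟨g, hg, hgφ⟩ := BinaryForms.exists_contract_eq_zero_of_mem_secantVariety hsec
  have hspan : BinaryForms.SpannedByPoints (n + 1) (Projectivization.mk K φ hφ).rep :=
    ha ▸ ((BinaryForms.spannedByPoints_rank (by omega) φ).mono (by omega)).smul (a : K)
  exact hplane ((hspan.of_contract_eq_zero hg hgφ).onSecantPlane (by omega))

theorem mainTheorem2 {K : Type*} [Field K] [IsAlgClosed K] [CharZero K]
    (d k : ℕ) (hd : 1 ≤ d) (hk : k ≤ (d - 1) / 2)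
    (φ : BinaryForms.Functional K d) (hφ : φ ≠ 0)
    (hsec : Projectivization.mk K φ hφ ∈ BinaryForms.secantVariety K d k)
    (hplane : ¬ BinaryForms.OnSecantPlane d k (Projectivization.mk K φ hφ)) :
    d - k + 1 ≤ BinaryForms.rank d φ := by
  exact mainTheorem2_general (by omega) φ hφ hsec hplane
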